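/- Let $n \ge 0$ be an integer, let $S_{2n}$ be the symmetric group on $\{1,\dots,2n\}$, and let $B_n \subseteq S_{2n}$ be the hyperoctahedral group, i.e. the stabilizer (under conjugation) of the fixed-point-free involution $\sigma = (1\,2)(3\,4)\cdots(2n-1\;2n)$. For a partition $\lambda \vdash 2n$ let $S^\lambda$ denote the complex Specht module: the subrepresentation, of the permutation representation of $S_{2n}$ on formal $\mathbb{C}$-linear combinations of tabloids of shape $\lambda$, spanned by the polytabloids $e_t = \sum_{\pi \in C_t} \operatorname{sgn}(\pi)\,\{\pi t\}$, where $t$ runs over the tableaux of shape $\lambda$ (bijective fillings of its diagram by $1,\dots,2n$), $\{t\}$ is the row-equivalence class of $t$, and $C_t$ is the group of permutations preserving every column of $t$. Call $\lambda$ even if all of its parts are even. Then the decomposition into irreducibles of the complex representation of $S_{2n}$ induced from the trivial representation of $B_n$ is $$\operatorname{Ind}_{B_n}^{S_{2n}}(1) \;\cong\; \bigoplus_{\substack{\lambda \vdash 2n \\ \lambda \text{ even}}} S^\lambda .$$ That is, the two sides are isomorphic as complex representations of $S_{2n}$, every summand $S^\lambda$ on the right is irreducible, and the summands are pairwise non-isomorphic,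 so that the decomposition is multiplicity-free. -/

import Mathlib

open scoped MonoidAlgebra

namespace SpechtMatching

/-- The partner of `i` in the perfect matching `01 | 23 | 45 | ⋯` of `{0, …, 2n - 1}`. -/
def partner (n : ℕ) (i : Fin (2 * n)) : Fin (2 * n) :=
  if h : Even (i : ℕ) then
    ⟨i + 1, by obtain ⟨k, hk⟩ := h; have := i.isLt; omega⟩
  else ⟨i - 1, by have := i.isLt; omega⟩

theorem partner_involutive (n : ℕ) : Function.Involutive (partner n) := by
  intro i
  apply Fin.ext
  rcases Nat.even_or_odd (i : ℕ) with h | h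
  · have h' : ¬ Even ((i : ℕ) + 1) := by simpa [Nat.even_add_one] using h
    simp [partner, h, h']
  · have h' : ¬ Even (i : ℕ) := by simpa using h
    have h'' : Even ((i : ℕ) - 1) := by obtain ⟨k, hk⟩ := h; exact ⟨k, by omega⟩
    have : 1 ≤ (i : ℕ) := by obtain ⟨k, hk⟩ := h; omega
    simp [partner, h', h'', this]

/-- The permutation `(0 1)(2 3)⋯(2n-2 2n-1)`. -/
def matching (n : ℕ) : Equiv.Perm (Fin (2 * n)) :=
  (partner_involutive n).toPerm

/-- The hyperoctahedral group: the stabilizer of the permutation `(0 1)(2 3)⋯(2n-2 2n-1)` under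
conjugation. -/
def hyperoctahedral (n : ℕ) : Subgroup (Equiv.Perm (Fin (2 * n))) :=
  Subgroup.centralizer {matching n}

/-- The Young diagram of a partition; its rows are the parts in weakly decreasing order. -/
def diagram {N : ℕ} (l : N.Partition) : YoungDiagram :=
  YoungDiagram.ofRowLens (l.parts.sort (· ≥ ·)) (l.parts.pairwise_sort (· ≥ ·)).sortedGE

/-- A tableau of shape `l ⊢ N`: a bijective filling of the cells of the diagram with the numbers
`0, …, N - 1`. -/
def Tableau {N : ℕ} (l : N.Partition) : Type :=
  {c : ℕ × ℕ // c ∈ (diagram l).cells} ≃ Fin N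

section

variable {N : ℕ} {l : N.Partition}

/-- The row of a tableau that contains the entry `k`. -/
def Tableau.row (t : Tableau l) (k : Fin N) : ℕ := (Equiv.symm t k).1.1

/-- The column of a tableau that contains the entry `k`. -/
def Tableau.col (t : Tableau l) (k : Fin N) : ℕ := (Equiv.symm t k).1.2

/-- Permutations act on tableaux by acting on the entries. -/
instance : MulAction (Equiv.Perm (Fin N)) (Tableau l) where
  smul g t := Equiv.trans t g
  one_smul _ := rfl
  mul_smul _ _ _ := rfl

theorem Tableau.row_smul (g : Equiv.Perm (Fin N)) (t : Tableau l) (k : Fin N) :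
    (g • t).row k = t.row (g⁻¹ k) := rfl

theorem Tableau.col_smul (g : Equiv.Perm (Fin N)) (t : Tableau l) (k : Fin N) :
    (g • t).col k = t.col (g⁻¹ k) := rfl

/-- Two tableaux are row equivalent if every entry lies in the same row of both. -/
instance rowSetoid (l : N.Partition) : Setoid (Tableau l) :=
  Setoid.ker Tableau.row

variable (l) in
/-- A tabloid is a row equivalence class of tableaux. -/
def Tabloid : Type := Quotient (rowSetoid l)

/-- The tabloid of a tableau. -/
def Tableau.tabloid (t : Tableau l) : Tabloid l := Quotient.mk (rowSetoid l) t

theorem Tableau.tabloid_eq_iff {s t : Tableau l} : s.tabloid = t.tabloid ↔ s.row = t.row :=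
  Quotient.eq

instance : MulAction (Equiv.Perm (Fin N)) (Tabloid l) where
  smul g := Quotient.map (g • ·) fun s t (h : s.row = t.row) =>
    show (g • s).row = (g • t).row from
      funext fun k => by rw [Tableau.row_smul, Tableau.row_smul, h]
  one_smul x := Quotient.inductionOn x fun _ => rfl
  mul_smul _ _ x := Quotient.inductionOn x fun _ => rfl

theorem smul_tabloid (g : Equiv.Perm (Fin N)) (t : Tableau l) :
    g • t.tabloid = (g • t).tabloid := rfl

/-- The column stabilizer `C_t` of a tableau `t`: the permutations of the entries that preserve
every column of `t`. -/
def Tableau.columnStabilizer (t : Tableau l) : Subgroup (Equiv.Perm (Fin N)) where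
  carrier := {g | ∀ k, t.col (g k) = t.col k}
  one_mem' _ := rfl
  mul_mem' {g h} hg hh k := (hg (h k)).trans (hh k)
  inv_mem' {g} hg k := by simpa using (hg (g⁻¹ k)).symm

theorem Tableau.mem_columnStabilizer {t : Tableau l} {g : Equiv.Perm (Fin N)} :
    g ∈ t.columnStabilizer ↔ ∀ k, t.col (g k) = t.col k := Iff.rfl

instance (t : Tableau l) : DecidablePred (· ∈ t.columnStabilizer) :=
  fun g => inferInstanceAs (Decidable (∀ k, t.col (g k) = t.col k))

variable (l) in
/-- The permutation module `M^l` spanned by the tabloids of shape `l`. -/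
noncomputable def permutationModule :
    Representation ℂ (Equiv.Perm (Fin N)) ℂ[Tabloid l] :=
  Representation.ofMulAction ℂ (Equiv.Perm (Fin N)) (Tabloid l)

/-- The polytabloid `e_t = ∑_{π ∈ C_t} sgn(π) {π t}`. -/
noncomputable def Tableau.polytabloid (t : Tableau l) : ℂ[Tabloid l] :=
  ∑ g : Equiv.Perm (Fin N) with g ∈ t.columnStabilizer,
    MonoidAlgebra.single (g • t).tabloid (((Equiv.Perm.sign g : ℤˣ) : ℤ) : ℂ)

theorem permutationModule_polytabloid (g : Equiv.Perm (Fin N)) (t : Tableau l) :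
    permutationModule l g t.polytabloid = (g • t).polytabloid := by
  simp only [Tableau.polytabloid, map_sum, permutationModule, Representation.ofMulAction_single,
    smul_tabloid]
  refine Finset.sum_equiv (MulAut.conj g).toEquiv (fun h => ?_) (fun h _ => ?_)
  · simp only [Finset.mem_filter, Finset.mem_univ, true_and, Tableau.mem_columnStabilizer,
      Tableau.col_smul]
    constructor
    · intro H k
      simpa using H (g⁻¹ k)
    · intro H k
      simpa using H (g k)
  · have hs : Equiv.Perm.sign (g * h * g⁻¹) = Equiv.Perm.sign h := by
      rw [Equiv.Perm.sign_mul, Equiv.Perm.sign_mul, Equiv.Perm.sign_inv, mul_right_comm,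
        Int.units_mul_self, one_mul]
    change _ = MonoidAlgebra.single (((g * h * g⁻¹) • g • t).tabloid)
      (((Equiv.Perm.sign (g * h * g⁻¹) : ℤˣ) : ℤ) : ℂ)
    rw [hs, smul_smul, smul_smul, inv_mul_cancel_right]

variable (l) in
/-- The complex Specht module `S^l`: the subrepresentation of `M^l` spanned by the polytabloids. -/
noncomputable def spechtModule : Subrepresentation (permutationModule l) where
  toSubmodule := Submodule.span ℂ (Set.range (Tableau.polytabloid (l := l)))
  apply_mem_toSubmodule g v hv := by
    induction hv using Submodule.span_induction with
    | mem x hx =>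
      obtain ⟨t, rfl⟩ := hx
      rw [permutationModule_polytabloid]
      exact Submodule.subset_span ⟨_, rfl⟩
    | zero => simp
    | add x y _ _ hx hy => rw [map_add]; exact Submodule.add_mem _ hx hy
    | smul a x _ hx => rw [map_smul]; exact Submodule.smul_mem _ a hx

variable (l) in
/-- The Specht module as a representation of the symmetric group. -/
noncomputable def specht :
    Representation ℂ (Equiv.Perm (Fin N)) (spechtModule l).toSubmodule :=
  (spechtModule l).toRepresentation

end

/-- The partitions of `N` all of whose parts are even. -/
abbrev EvenPartition (N : ℕ) : Type := {l : N.Partition // ∀ i ∈ l.parts, Even i}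

/-- The representation of the symmetric group on `2n` letters that is induced from the trivial
one-dimensional complex representation of the hyperoctahedral group. -/
noncomputable def inducedTrivial (n : ℕ) :
    Representation ℂ (Equiv.Perm (Fin (2 * n)))
      (Representation.IndV (hyperoctahedral n).subtype
        (Representation.trivial ℂ (hyperoctahedral n) ℂ)) :=
  Representation.ind (hyperoctahedral n).subtype
    (Representation.trivial ℂ (hyperoctahedral n) ℂ)

end SpechtMatching

/-!
Let `B_n` be the centralizer of the matching `x = (0 1)(2 3)⋯`.

If all parts of `λ` are even, some tableau `t` is adapted to `x`: the matching exchanges the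
entries in the columns `2k` and `2k + 1` of each row. Every term of the polytabloid `e_t` that is
fixed by `x` comes from a column permutation commuting with `x`, which acts on the even columns as
on the odd ones and is therefore even. So the sum of the coefficients at the tabloids fixed by `x`
is a `B_n`-invariant functional that is positive on `e_t`, and Frobenius reciprocity gives a
nonzero map from the induced representation onto the irreducible `S^λ`.

There is no room for anything else. The double cosets of `B_n` inject into the conjugacy classes of
`S_n`, because two perfect matchings of `2n` points form a bipartite graph and so differ by a
permutation of one side; hence the endomorphism algebra of the induced representation has dimension
at most the number of partitions of `n`, that is, of even partitions of `2n`. The idempotents that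
project to the pairwise non-isomorphic `S^λ` are therefore a basis of this algebra, and their sum
is `1`.

Irreducibility and the distinction of the `S^λ` follow James: the column antisymmetrizer `κ_t` maps
the permutation module `M^λ` into the line of `e_t` and kills `M^μ` unless `λ` dominates `μ`, while
no nonzero vector of `S^λ` is killed by every `κ_t`, since it would be orthogonal to all `e_t`.
-/

namespace SpechtMatching

open Finset

section Idempotents

variable {k A ι : Type*} [Field k] [Semiring A] [Algebra k A] {e : ι → A}

theorem linearIndependent_of_orthogonalIdempotents (he : OrthogonalIdempotents e)
    (hne : ∀ i, e i ≠ 0) : LinearIndependent k e := by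
  let _ : Ring A := Algebra.semiringToRing k
  refine linearIndependent_iff'.2 fun s c hc i hi => ?_
  have hmul : e i * ∑ j ∈ s, c j • e j = c i • e i := by
    rw [mul_sum, sum_eq_single_of_mem i hi, mul_smul_comm, he.idem i]
    intro j _ hji
    rw [mul_smul_comm, he.ortho hji.symm, smul_zero]
  rw [hc, mul_zero] at hmul
  exact (smul_eq_zero.1 hmul.symm).resolve_right (hne i)

theorem completeOrthogonalIdempotents_of_finrank_le [Module.Finite k A] [Fintype ι]
    (he : OrthogonalIdempotents e) (hne : ∀ i, e i ≠ 0)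
    (hrank : Module.finrank k A ≤ Fintype.card ι) : CompleteOrthogonalIdempotents e := by
  classical
  let _ : Ring A := Algebra.semiringToRing k
  have hli : LinearIndependent k e := linearIndependent_of_orthogonalIdempotents he hne
  have hspan : Submodule.span k (Set.range e) = ⊤ :=
    hli.span_eq_top_of_card_eq_finrank' (hli.fintype_card_le_finrank.antisymm hrank)
  have hone : (1 : A) ∈ Submodule.span k (Set.range e) := hspan ▸ Submodule.mem_top
  obtain ⟨c, hc⟩ := (Submodule.mem_span_range_iff_exists_fun k).1 hone
  have hsmul (i : ι) : c i • e i = e i := by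
    conv_rhs => rw [← mul_one (e i), ← hc, mul_sum]
    simp [he.mul_eq]
  exact ⟨he, by simpa only [hsmul] using hc⟩

end Idempotents

section DirectSum

variable {k G V U ι : Type*} [Field k] [Group G] [AddCommGroup V] [Module k V]
  [AddCommGroup U] [Module k U] {ρ : Representation k G V} {τ : Representation k G U}

theorem isCompl_toSubmodule {C D : Subrepresentation ρ} (h : IsCompl C D) :
    IsCompl C.toSubmodule D.toSubmodule where
  disjoint := disjoint_iff.2 <| by rw [← Subrepresentation.toSubmodule_inf, h.inf_eq_bot]; rfl
  codisjoint := codisjoint_iff.2 <| by rw [← Subrepresentation.toSubmodule_sup, h.sup_eq_top]; rfl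

theorem exists_rightInverse_intertwiningMap [ρ.IsSemisimpleRepresentation]
    (f : ρ.IntertwiningMap τ) (hf : Function.Surjective f) :
    ∃ s : τ.IntertwiningMap ρ, Function.RightInverse s f := by
  obtain ⟨C, hC⟩ := exists_isCompl f.ker
  have hC' := isCompl_toSubmodule hC.symm
  let r : C.toRepresentation.IntertwiningMap τ :=
    { toLinearMap := f.toLinearMap.domRestrict C.toSubmodule
      isIntertwining' := fun g => LinearMap.ext fun v => f.isIntertwining _ _ g v.1 }
  let e := r.ofBijective ⟨LinearMap.injective_domRestrict_iff.2 hC'.disjoint,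
    (LinearMap.surjective_domRestrict_iff hf).2 hC'.codisjoint⟩
  refine ⟨{ toLinearMap := C.toSubmodule.subtype ∘ₗ e.symm.toLinearMap
            isIntertwining' := fun g => LinearMap.ext fun u =>
              congrArg Subtype.val (e.symm.toIntertwiningMap.isIntertwining _ _ g u) }, fun u => ?_⟩
  exact e.apply_symm_apply u

variable {W : ι → Type*} [∀ i, AddCommGroup (W i)] [∀ i, Module k (W i)]
  {σ : ∀ i, Representation k G (W i)}

section

variable [Fintype ι] [DecidableEq ι]

/-- The homomorphism `v ↦ (f i v)ᵢ` into a finite direct sum. -/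
noncomputable def toDirectSum (f : ∀ i, ρ.IntertwiningMap (σ i)) :
    ρ.IntertwiningMap (Representation.directSum σ) where
  toLinearMap := ∑ i, DirectSum.lof k ι W i ∘ₗ (f i).toLinearMap
  isIntertwining' g := by
    ext v i
    simp [DirectSum.lmap_lof, Representation.IntertwiningMap.isIntertwining]

theorem toDirectSum_apply (f : ∀ i, ρ.IntertwiningMap (σ i)) (v : V) (i : ι) :
    toDirectSum f v i = f i v := by
  change (∑ i, DirectSum.lof k ι W i ∘ₗ (f i).toLinearMap) v i = _
  rw [LinearMap.sum_apply, DirectSum.sum_apply, sum_eq_single i]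
  · exact DirectSum.lof_apply k i _
  · exact fun j _ hj => DirectSum.of_eq_of_ne _ _ _ hj.symm
  · simp

theorem toDirectSum_bijective {f : ∀ i, ρ.IntertwiningMap (σ i)}
    {s : ∀ i, (σ i).IntertwiningMap ρ} (hs : ∀ i, Function.RightInverse (s i) (f i))
    (hdisj : Pairwise fun i j => (f i).comp (s j) = 0)
    (hone : ∑ i, (s i).comp (f i) = 1) : Function.Bijective (toDirectSum f) := by
  constructor
  · refine (injective_iff_map_eq_zero _).2 fun v hv => ?_
    have hfv (i : ι) : f i v = 0 := by rw [← toDirectSum_apply, hv]; rfl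
    calc v = ∑ i, s i (f i v) := by
          simpa [Representation.IntertwiningMap.sum_apply] using (DFunLike.congr_fun hone v).symm
      _ = 0 := by simp [hfv]
  · intro w
    refine ⟨∑ i, s i (w i), DFinsupp.ext fun j => ?_⟩
    change toDirectSum f _ j = _
    rw [toDirectSum_apply, map_sum, sum_eq_single j, hs]
    · exact fun i _ hij => DFunLike.congr_fun (hdisj hij.symm) (w i)
    · simp

end

theorem orthogonalIdempotents_comp {f : ∀ i, ρ.IntertwiningMap (σ i)}
    {s : ∀ i, (σ i).IntertwiningMap ρ} (hs : ∀ i, Function.RightInverse (s i) (f i))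
    (hdisj : Pairwise fun i j => (f i).comp (s j) = 0) :
    OrthogonalIdempotents (R := ρ.IntertwiningMap ρ) fun i => (s i).comp (f i) where
  idem i := DFunLike.ext _ _ fun v => congrArg (s i) (hs i (f i v))
  ortho i j hij := DFunLike.ext _ _ fun v =>
    (congrArg (s i) (DFunLike.congr_fun (hdisj hij) (f j v))).trans (map_zero (s i))

theorem nonempty_equiv_directSum [ρ.IsSemisimpleRepresentation] [FiniteDimensional k V]
    [Fintype ι] (hσ : ∀ i, (σ i).IsIrreducible)
    (hne : ∀ i j, Nonempty ((σ i).Equiv (σ j)) → i = j)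
    (f : ∀ i, ρ.IntertwiningMap (σ i)) (hf : ∀ i, f i ≠ 0)
    (hrank : Module.finrank k (ρ.IntertwiningMap ρ) ≤ Fintype.card ι) :
    Nonempty (ρ.Equiv (Representation.directSum σ)) := by
  classical
  choose s hs using fun i => exists_rightInverse_intertwiningMap (f i)
    ((Representation.IsIrreducible.surjective_or_eq_zero (f i)).resolve_right (hf i))
  have hdisj : Pairwise fun i j => (f i).comp (s j) = 0 := fun i j hij =>
    (Representation.IsIrreducible.bijective_or_eq_zero ((f i).comp (s j))).resolve_left
      fun h => hij (hne j i ⟨((f i).comp (s j)).ofBijective h⟩).symm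
  have hidem_ne (i : ι) : (s i).comp (f i) ≠ 0 := fun h => hf i <| DFunLike.ext _ _ fun v => by
    rw [← hs i (f i v)]
    exact (congrArg (f i) (DFunLike.congr_fun h v)).trans (map_zero (f i))
  have hcomplete := completeOrthogonalIdempotents_of_finrank_le
    (orthogonalIdempotents_comp hs hdisj) hidem_ne hrank
  exact ⟨(toDirectSum f).ofBijective (toDirectSum_bijective hs hdisj hcomplete.complete)⟩

end DirectSum

section InvariantFunctional

variable {k G V : Type*} [CommRing k] [Group G] [Fintype G] [Invertible (Fintype.card G : k)]
  [AddCommGroup V] [Module k V] {ρ : Representation k G V}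

theorem apply_averageMap {φ : V →ₗ[k] k} (hφ : ∀ g, φ ∘ₗ ρ g = φ) (v : V) :
    φ (ρ.averageMap v) = φ v := by
  have hφ' (g : G) : φ (ρ g v) = φ v := LinearMap.congr_fun (hφ g) v
  simp [Representation.averageMap, GroupAlgebra.average, map_sum, hφ', card_univ]

theorem averageMap_apply_self (g : G) (v : V) : ρ.averageMap (ρ g v) = ρ.averageMap v := by
  rw [Representation.averageMap, ← Representation.asAlgebraHom_single_one,
    ← Module.End.mul_apply, ← map_mul, GroupAlgebra.mul_average_right]

end InvariantFunctional

section CosetRepresentation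

variable {k G V : Type*} [CommRing k] [Group G] {H : Subgroup G} [AddCommGroup V] [Module k V]
  {τ : Representation k G V}

/-- The restriction of a representation of `G` to the subgroup `H`. -/
abbrev restriction (τ : Representation k G V) (H : Subgroup G) : Representation k H V :=
  τ.comp H.subtype

variable (k H) in
/-- The space of the representation of `G` induced from the trivial representation of `H`. -/
abbrev CosetModule : Type _ := Representation.IndV H.subtype (Representation.trivial k H k)

variable (k H) in
/-- The representation of `G` induced from the trivial representation of `H`. -/
noncomputable abbrev cosetRepresentation : Representation k G (CosetModule k H) :=
  Representation.ind H.subtype (Representation.trivial k H k)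

variable (k H) in
/-- The generator `⟦g ⊗ 1⟧` of the induced representation. It depends only on the right coset
`H g`, and `h : G` sends it to the generator of `g * h⁻¹`. -/
noncomputable def cosetVector (g : G) : CosetModule k H := Representation.IndV.mk _ _ g 1

theorem cosetRepresentation_cosetVector (h g : G) :
    cosetRepresentation k H h (cosetVector k H g) = cosetVector k H (g * h⁻¹) :=
  Representation.ind_mk ..

theorem cosetVector_eq_apply_one (g : G) :
    cosetVector k H g = cosetRepresentation k H g⁻¹ (cosetVector k H 1) := by
  rw [cosetRepresentation_cosetVector, one_mul, inv_inv]

theorem cosetVector_mul {h : G} (hh : h ∈ H) (g : G) :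
    cosetVector k H (h * g) = cosetVector k H g := by
  refine (Representation.Coinvariants.mk_eq_iff _).2 ?_
  refine Representation.Coinvariants.mem_ker_of_eq (⟨h, hh⟩ : H)
    (TensorProduct.tmul k (.single g 1) 1) _ ?_
  simp

theorem cosetVector_one_mem_invariants :
    cosetVector k H 1 ∈ (restriction (cosetRepresentation k H) H).invariants := fun h => by
  change cosetRepresentation k H h _ = _
  rw [cosetRepresentation_cosetVector, one_mul, ← mul_one (h : G)⁻¹, cosetVector_mul (inv_mem h.2)]

theorem span_cosetVector : Submodule.span k (Set.range (cosetVector k H)) = ⊤ := by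
  rw [← Submodule.ker_mkQ (Submodule.span k (Set.range (cosetVector k H))), LinearMap.ker_eq_top]
  refine Representation.IndV.hom_ext _ _ fun g => LinearMap.ext_ring ?_
  exact (Submodule.Quotient.mk_eq_zero _).2 (Submodule.subset_span ⟨g, rfl⟩)

instance [Finite G] : Module.Finite k (CosetModule k H) :=
  ⟨⟨(Set.finite_range (cosetVector k H)).toFinset, by simpa using span_cosetVector⟩⟩

/-- The map out of the induced representation that corresponds to an `H`-invariant vector under
Frobenius reciprocity. -/
noncomputable def cosetLift (v : V) (hv : v ∈ (restriction τ H).invariants) :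
    (cosetRepresentation k H).IntertwiningMap τ where
  toLinearMap := Representation.Coinvariants.lift _
    (TensorProduct.lift <| (Finsupp.lift _ _ _ fun g =>
      LinearMap.toSpanSingleton k V (τ g⁻¹ v)) ∘ₗ
      (MonoidAlgebra.coeffLinearEquiv k).toLinearMap)
    fun h ↦ by
      ext g
      simpa [Representation.ofMulAction_single] using congrArg (τ g⁻¹) (hv h⁻¹)
  isIntertwining' g := by
    ext h
    simp

theorem cosetLift_cosetVector_one (v : V) (hv : v ∈ (restriction τ H).invariants) :
    cosetLift v hv (cosetVector k H 1) = v := by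
  change (cosetLift v hv).toLinearMap _ = v
  simp [cosetLift, cosetVector]

theorem exists_intertwiningMap_ne_zero [Fintype H] [Invertible (Fintype.card H : k)]
    {φ : V →ₗ[k] k} (hφ : ∀ h ∈ H, φ ∘ₗ τ h = φ) (hne : φ ≠ 0) :
    ∃ f : (cosetRepresentation k H).IntertwiningMap τ, f ≠ 0 := by
  obtain ⟨v, hv⟩ := DFunLike.exists_ne hne
  refine ⟨cosetLift _ ((restriction τ H).averageMap_invariant v), fun hf => hv ?_⟩
  rw [← apply_averageMap (ρ := restriction τ H) (fun h => hφ h h.2) v,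
    ← cosetLift_cosetVector_one _ ((restriction τ H).averageMap_invariant v), hf]
  exact map_zero φ

variable (k H τ) in
/-- Evaluation at the generator of the induced representation; Frobenius reciprocity says that
it identifies `G`-homomorphisms with `H`-invariant vectors. -/
noncomputable def evalCosetVectorOne :
    (cosetRepresentation k H).IntertwiningMap τ →ₗ[k] (restriction τ H).invariants where
  toFun f := ⟨f (cosetVector k H 1), fun h => (f.isIntertwining _ _ (h : G) _).symm.trans
    (congrArg f (cosetVector_one_mem_invariants h))⟩
  map_add' _ _ := rfl
  map_smul' _ _ := rfl

theorem evalCosetVectorOne_injective : Function.Injective (evalCosetVectorOne k H τ) := by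
  intro f f' h
  have hone : f (cosetVector k H 1) = f' (cosetVector k H 1) := congrArg Subtype.val h
  refine Representation.IntertwiningMap.ext (LinearMap.ext_on_range span_cosetVector fun g => ?_)
  change f _ = f' _
  rw [cosetVector_eq_apply_one, f.isIntertwining, f'.isIntertwining, hone]

end CosetRepresentation

section DoubleCosets

variable {k G : Type*} [Group G] {H : Subgroup G}

theorem averageMap_cosetVector_eq [CommRing k] [Fintype H] [Invertible (Fintype.card H : k)]
    {g g' : G} (h : DoubleCoset.mk H H g = DoubleCoset.mk H H g') :
    (restriction (cosetRepresentation k H) H).averageMap (cosetVector k H g) =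
      (restriction (cosetRepresentation k H) H).averageMap (cosetVector k H g') := by
  obtain ⟨a, ha, b, hb, rfl⟩ := (DoubleCoset.eq H H g g').1 h
  rw [mul_assoc, cosetVector_mul ha,
    ← averageMap_apply_self (⟨b, hb⟩ : H) (cosetVector k H (g * b))]
  congr 1
  change _ = cosetRepresentation k H b _
  rw [cosetRepresentation_cosetVector, mul_inv_cancel_right]

theorem invariants_le_span_averageMap [CommRing k] [Fintype H] [Invertible (Fintype.card H : k)] :
    (restriction (cosetRepresentation k H) H).invariants ≤
      Submodule.span k (Set.range fun q : DoubleCoset.Quotient (H : Set G) H =>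
        (restriction (cosetRepresentation k H) H).averageMap (cosetVector k H q.out)) := by
  intro v hv
  rw [← Representation.averageMap_id _ v hv]
  have hspan := Submodule.mem_map_of_mem (f := (restriction (cosetRepresentation k H) H).averageMap)
    (span_cosetVector (k := k) (H := H) ▸ Submodule.mem_top (x := v))
  rw [Submodule.map_span, ← Set.range_comp] at hspan
  refine Submodule.span_mono ?_ hspan
  rintro _ ⟨g, rfl⟩
  exact ⟨DoubleCoset.mk H H g, averageMap_cosetVector_eq (DoubleCoset.out_eq' H H _)⟩

theorem finrank_intertwiningMap_cosetRepresentation_le [Field k] [Finite G]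
    [NeZero (Nat.card H : k)] :
    Module.finrank k ((cosetRepresentation k H).IntertwiningMap (cosetRepresentation k H)) ≤
      Nat.card (DoubleCoset.Quotient (H : Set G) H) := by
  have : Fintype H := .ofFinite H
  have : Invertible (Fintype.card H : k) :=
    invertibleOfNonzero (Nat.card_eq_fintype_card (α := H) ▸ NeZero.ne _)
  have : Finite (DoubleCoset.Quotient (H : Set G) H) := Quotient.finite _
  have : Fintype (DoubleCoset.Quotient (H : Set G) H) := .ofFinite _
  rw [Nat.card_eq_fintype_card]
  calc Module.finrank k ((cosetRepresentation k H).IntertwiningMap (cosetRepresentation k H))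
    _ ≤ Module.finrank k (restriction (cosetRepresentation k H) H).invariants :=
        LinearMap.finrank_le_finrank_of_injective evalCosetVectorOne_injective
    _ ≤ Module.finrank k _ := Submodule.finrank_mono invariants_le_span_averageMap
    _ ≤ _ := finrank_range_le_card _

end DoubleCosets

section Matchings

variable {α β ι κ : Type*}

/-- A perfect matching of `α`, encoded as a fixed-point-free involution. -/
structure IsMatching (x : Equiv.Perm α) : Prop where
  mul_self : x * x = 1
  apply_ne (a : α) : x a ≠ a

theorem IsMatching.apply_apply {x : Equiv.Perm α} (hx : IsMatching x) (a : α) : x (x a) = a :=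
  Equiv.congr_fun hx.mul_self a

theorem IsMatching.conj {x : Equiv.Perm α} (hx : IsMatching x) (g : Equiv.Perm α) :
    IsMatching (g * x * g⁻¹) where
  mul_self := by rw [conj_mul, hx.mul_self, mul_one, mul_inv_cancel]
  apply_ne a h := hx.apply_ne (g⁻¹ a) (Equiv.Perm.eq_inv_iff_eq.2 h)

theorem IsMatching.conj_zpow_mul {x y : Equiv.Perm α} (hx : IsMatching x) (hy : IsMatching y)
    (j : ℤ) (a : α) : x (((x * y) ^ j) a) = ((x * y) ^ (-j)) (x a) := by
  have hconj : x * (x * y) * x⁻¹ = (x * y)⁻¹ := by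
    rw [mul_inv_rev, inv_eq_of_mul_eq_one_left hx.mul_self,
      inv_eq_of_mul_eq_one_left hy.mul_self, ← mul_assoc, hx.mul_self, one_mul]
  have hpow := congrArg (fun z => (z ^ j) (x a)) hconj
  simp only [conj_zpow, inv_zpow'] at hpow
  simpa using hpow

/-- In the dihedral group generated by `x` and `y`, an element `x (x y) ^ k` is conjugate to `x` or
to `y` according to the parity of `k`, and so has no fixed points. -/
theorem IsMatching.not_sameCycle_mul {x y : Equiv.Perm α} (hx : IsMatching x) (hy : IsMatching y)
    (a : α) : ¬ (x * y).SameCycle a (x a) := by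
  rintro ⟨k, hk⟩
  obtain ⟨j, rfl | rfl⟩ := Int.even_or_odd' k
  · apply hx.apply_ne (((x * y) ^ j) a)
    rw [hx.conj_zpow_mul hy, ← hk, ← Equiv.Perm.mul_apply, ← zpow_add]
    congr 2
    ring
  · apply hy.apply_ne (((x * y) ^ j) a)
    have hyx : y (((x * y) ^ j) a) = x (((x * y) ^ (1 + j)) a) := by
      rw [zpow_one_add]
      exact (hx.apply_apply _).symm
    rw [hyx, hx.conj_zpow_mul hy, ← hk, ← Equiv.Perm.mul_apply, ← zpow_add]
    congr 2
    ring

/-- The union of two perfect matchings is a bipartite graph. -/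
theorem IsMatching.exists_transversal {x y : Equiv.Perm α} (hx : IsMatching x)
    (hy : IsMatching y) : ∃ D : Set α, ∀ a, (x a ∈ D ↔ a ∉ D) ∧ (y a ∈ D ↔ a ∉ D) := by
  classical
  let c : α → Quotient (Equiv.Perm.SameCycle.setoid (x * y)) := Quotient.mk _
  have hc_mul (a : α) : c ((x * y) a) = c a :=
    Quotient.sound (Equiv.Perm.sameCycle_apply_left.2 (.refl _ _))
  have hc_x (a : α) : c a ≠ c (x a) := fun h => hx.not_sameCycle_mul hy a (Quotient.exact h)
  have hc_y (a : α) : c (y a) = c (x a) := by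
    rw [← hc_mul (y a), Equiv.Perm.mul_apply, hy.apply_apply]
  have hc_xy (a : α) : c (x (y a)) = c a := hc_mul a
  let _ : LinearOrder (Quotient (Equiv.Perm.SameCycle.setoid (x * y))) :=
    linearOrderOfSTO WellOrderingRel
  refine ⟨{a | c a < c (x a)}, fun a => ?_⟩
  simp only [Set.mem_ofPred_eq, hx.apply_apply, hc_xy, hc_y, not_lt, and_self]
  exact ⟨le_of_lt, fun h => h.lt_of_ne (hc_x a).symm⟩

/-- The matching of `ι × Bool` that joins `(i, false)` to `(q i, true)`. -/
def twistedSwap (q : Equiv.Perm ι) : Equiv.Perm (ι × Bool) :=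
  Function.Involutive.toPerm (fun p => bif p.2 then (q⁻¹ p.1, false) else (q p.1, true))
    fun p => by rcases p with ⟨i, _ | _⟩ <;> simp

theorem prodCongr_permCongr_twistedSwap (r : ι ≃ κ) (q : Equiv.Perm ι) :
    (r.prodCongr (.refl Bool)).permCongr (twistedSwap q) = twistedSwap (r.permCongr q) := by
  ext1 ⟨i, _ | _⟩
  · simp [twistedSwap]
  · simp [twistedSwap, Equiv.Perm.inv_def, Equiv.permCongr_def]

theorem IsMatching.eq_permCongr_twistedSwap {x : Equiv.Perm α} (hx : IsMatching x)
    {e : ι × Bool ≃ α} {q : Equiv.Perm ι} (h : ∀ i, x (e (i, false)) = e (q i, true)) :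
    x = e.permCongr (twistedSwap q) := by
  ext a
  obtain ⟨⟨i, _ | _⟩, rfl⟩ := e.surjective a
  · simp [twistedSwap, h]
  · obtain ⟨i, rfl⟩ := q.surjective i
    have hback : x (e (q i, true)) = e (i, false) := by rw [← h, hx.apply_apply]
    simp [twistedSwap, hback]

theorem IsMatching.exists_prod_bool_equiv_set {x y : Equiv.Perm α} (hx : IsMatching x)
    (hy : IsMatching y) : ∃ (D : Set α) (e : D × Bool ≃ α) (q : Equiv.Perm D),
      x = e.permCongr (twistedSwap 1) ∧ y = e.permCongr (twistedSwap q) := by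
  obtain ⟨D, hD⟩ := hx.exists_transversal hy
  let F : D × Bool → α := fun p => bif p.2 then x p.1 else p.1
  have hF : Function.Bijective F := by
    constructor
    · rintro ⟨⟨a, ha⟩, _ | _⟩ ⟨⟨b, hb⟩, _ | _⟩ h <;> simp only [F, cond_true, cond_false] at h
      · simp [h]
      · exact ((hD b).1.1 (h ▸ ha) hb).elim
      · exact ((hD a).1.1 (h ▸ hb) ha).elim
      · simp [x.injective h]
    · intro a
      by_cases ha : a ∈ D
      · exact ⟨(⟨a, ha⟩, false), rfl⟩
      · exact ⟨(⟨x a, (hD a).1.2 ha⟩, true), hx.apply_apply a⟩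
  have hmul (a : α) : (x * y) a ∈ D ↔ a ∈ D := by
    rw [Equiv.Perm.mul_apply, (hD _).1, (hD _).2, not_not]
  exact ⟨D, Equiv.ofBijective F hF, (x * y).subtypePerm hmul,
    hx.eq_permCongr_twistedSwap fun _ => rfl,
    hy.eq_permCongr_twistedSwap fun d => (hx.apply_apply (y d)).symm⟩

theorem IsMatching.exists_prod_bool_equiv [Finite α] [Finite ι] {x y : Equiv.Perm α}
    (hx : IsMatching x) (hy : IsMatching y) (hcard : Nat.card α = 2 * Nat.card ι) :
    ∃ (e : ι × Bool ≃ α) (q : Equiv.Perm ι),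
      x = e.permCongr (twistedSwap 1) ∧ y = e.permCongr (twistedSwap q) := by
  obtain ⟨D, e, q, rfl, rfl⟩ := hx.exists_prod_bool_equiv_set hy
  have hD : Nat.card D = Nat.card ι := by
    have := Nat.card_congr e
    rw [Nat.card_prod, Nat.card_eq_fintype_card (α := Bool), Fintype.card_bool] at this
    omega
  obtain ⟨r⟩ := Finite.card_eq.1 hD
  have htransport (p : Equiv.Perm D) : e.permCongr (twistedSwap p) =
      ((r.prodCongr (.refl Bool)).symm.trans e).permCongr (twistedSwap (r.permCongr p)) := by
    rw [← prodCongr_permCongr_twistedSwap]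
    ext a
    simp [Prod.map_map]
  refine ⟨(r.prodCongr (.refl Bool)).symm.trans e, r.permCongr q, ?_, htransport q⟩
  rw [htransport, ← r.permCongrHom_coe, map_one]

theorem IsMatching.exists_permCongr_eq [Finite α] [Finite β] {x : Equiv.Perm α}
    {y : Equiv.Perm β} (hx : IsMatching x) (hy : IsMatching y) (hcard : Nat.card α = Nat.card β) :
    ∃ e : α ≃ β, e.permCongr x = y := by
  obtain ⟨D, e, -, rfl, -⟩ := hx.exists_prod_bool_equiv_set hx
  have hβ : Nat.card β = 2 * Nat.card D := by
    rw [← hcard, ← Nat.card_congr e, Nat.card_prod, Nat.card_eq_fintype_card (α := Bool),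
      Fintype.card_bool, mul_comm]
  obtain ⟨e', -, rfl, -⟩ := hy.exists_prod_bool_equiv hy hβ
  exact ⟨e.symm.trans e', by ext; simp⟩

/-- The double cosets of the centralizer of a matching are separated by the conjugacy class of the
twist between the matching and its conjugate. -/
theorem IsMatching.exists_conjClasses_invariant [Finite α] [Finite ι] {x : Equiv.Perm α}
    (hx : IsMatching x) (hcard : Nat.card α = 2 * Nat.card ι) :
    ∃ κ : Equiv.Perm α → ConjClasses (Equiv.Perm ι), ∀ g g', κ g = κ g' →
      DoubleCoset.mk (Subgroup.centralizer {x}) (Subgroup.centralizer {x}) g =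
        DoubleCoset.mk (Subgroup.centralizer {x}) (Subgroup.centralizer {x}) g' := by
  choose e q hx_eq hconj_eq using fun g => hx.exists_prod_bool_equiv (hx.conj g) hcard
  refine ⟨fun g => ConjClasses.mk (q g), fun g g' h => (DoubleCoset.eq _ _ _ _).2 ?_⟩
  obtain ⟨r, hr⟩ := isConj_iff.1 (ConjClasses.mk_eq_mk_iff_isConj.1 h)
  rw [← Equiv.permCongr_eq_mul] at hr
  let k : Equiv.Perm α := (e g).symm.trans ((r.prodCongr (.refl Bool)).trans (e g'))
  have hk (p : Equiv.Perm ι) : k * (e g).permCongr (twistedSwap p) * k⁻¹ =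
      (e g').permCongr (twistedSwap (r.permCongr p)) := by
    rw [← Equiv.permCongr_eq_mul, ← prodCongr_permCongr_twistedSwap]
    ext a
    simp [k]
  have hkx : k * x * k⁻¹ = x := by
    calc k * x * k⁻¹ = k * (e g).permCongr (twistedSwap 1) * k⁻¹ := by rw [← hx_eq g]
      _ = x := by rw [hk, ← r.permCongrHom_coe, map_one, ← hx_eq g']
  have hkg : k * (g * x * g⁻¹) * k⁻¹ = g' * x * g'⁻¹ := by
    rw [hconj_eq g, hk, hr, hconj_eq g']
  refine ⟨k, ?_, (k * g)⁻¹ * g', ?_, by group⟩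
  · exact Subgroup.mem_centralizer_singleton_iff.2 (mul_inv_eq_iff_eq_mul.1 hkx)
  · refine Subgroup.mem_centralizer_singleton_iff.2 (mul_inv_eq_iff_eq_mul.1 ?_)
    calc (k * g)⁻¹ * g' * x * ((k * g)⁻¹ * g')⁻¹
        = g⁻¹ * (k⁻¹ * (g' * x * g'⁻¹) * k) * g := by group
      _ = x := by rw [← hkg]; group

theorem IsMatching.card_doubleCoset_centralizer_le [Finite α] [Finite ι] {x : Equiv.Perm α}
    (hx : IsMatching x) (hcard : Nat.card α = 2 * Nat.card ι) :
    Nat.card (DoubleCoset.Quotient (Subgroup.centralizer {x} : Set (Equiv.Perm α))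
      (Subgroup.centralizer {x})) ≤ Nat.card (ConjClasses (Equiv.Perm ι)) := by
  obtain ⟨κ, hκ⟩ := hx.exists_conjClasses_invariant hcard
  have : Finite (ConjClasses (Equiv.Perm ι)) := Quotient.finite _
  refine Nat.card_le_card_of_injective (fun Q => κ Q.out) fun Q Q' h => ?_
  rw [← DoubleCoset.out_eq' _ _ Q, ← DoubleCoset.out_eq' _ _ Q']
  exact hκ _ _ h

end Matchings

section Partitions

theorem card_conjClasses_perm_le (α : Type*) [Fintype α] :
    Nat.card (ConjClasses (Equiv.Perm α)) ≤ Fintype.card (Fintype.card α).Partition := by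
  classical
  rw [← Nat.card_eq_fintype_card]
  refine Nat.card_le_card_of_injective
    (Quotient.lift Equiv.Perm.partition fun _ _ => Equiv.Perm.partition_eq_of_isConj.1) ?_
  rintro ⟨p⟩ ⟨q⟩ h
  exact Quotient.sound (Equiv.Perm.partition_eq_of_isConj.2 h)

/-- The partition of `2 * n` whose parts are twice those of `l`. -/
def doublePartition {n : ℕ} (l : n.Partition) : (2 * n).Partition where
  parts := l.parts.map (2 * ·)
  parts_pos {i} hi := by
    obtain ⟨j, hj, rfl⟩ := Multiset.mem_map.1 hi
    exact Nat.mul_pos two_pos (l.parts_pos hj)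
  parts_sum := by rw [Multiset.sum_map_mul_left, Multiset.map_id', l.parts_sum]

theorem doublePartition_injective (n : ℕ) : Function.Injective (doublePartition (n := n)) :=
  fun _ _ h => Nat.Partition.ext <|
    Multiset.map_injective (mul_right_injective₀ two_ne_zero) (congrArg Nat.Partition.parts h)

theorem card_partition_le_card_evenPartition (n : ℕ) :
    Fintype.card n.Partition ≤ Fintype.card (EvenPartition (2 * n)) := by
  refine Fintype.card_le_of_injective (fun l => ⟨doublePartition l, fun i hi => ?_⟩)
    fun l m h => doublePartition_injective n (congrArg Subtype.val h)
  obtain ⟨j, -, rfl⟩ := Multiset.mem_map.1 hi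
  exact even_two_mul j

end Partitions

section Hyperoctahedral

theorem isMatching_matching (n : ℕ) : IsMatching (matching n) where
  mul_self := Equiv.ext (partner_involutive n)
  apply_ne i h := by
    have := congrArg Fin.val h
    change (partner n i : ℕ) = i at this
    unfold partner at this
    split_ifs at this with hi
    · simp at this
    · obtain ⟨k, hk⟩ := Nat.not_even_iff_odd.1 hi
      simp only at this
      omega

theorem card_doubleCoset_hyperoctahedral_le (n : ℕ) :
    Nat.card (DoubleCoset.Quotient (hyperoctahedral n : Set (Equiv.Perm (Fin (2 * n))))
      (hyperoctahedral n)) ≤ Fintype.card (EvenPartition (2 * n)) :=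
  calc _ ≤ Nat.card (ConjClasses (Equiv.Perm (Fin n))) :=
        (isMatching_matching n).card_doubleCoset_centralizer_le (by simp)
    _ ≤ Fintype.card (Fintype.card (Fin n)).Partition := card_conjClasses_perm_le (Fin n)
    _ ≤ Fintype.card (EvenPartition (2 * n)) := by
        rw [Fintype.card_fin]
        exact card_partition_le_card_evenPartition n

end Hyperoctahedral

section YoungDiagrams

variable {N : ℕ}

theorem card_cellsOfRowLens (w : List ℕ) : (YoungDiagram.cellsOfRowLens w).card = w.sum := by
  induction w with
  | nil => rfl
  | cons a w ih =>
    rw [YoungDiagram.cellsOfRowLens, card_union_of_disjoint, card_map, ih]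
    · simp
    · rw [disjoint_left]
      rintro _ h₁ h₂
      obtain ⟨c, -, rfl⟩ := mem_map.1 h₂
      exact Nat.succ_ne_zero c.1 (mem_singleton.1 (mem_product.1 h₁).1)

theorem card_cells_diagram (l : N.Partition) : (diagram l).cells.card = N := by
  have h : (l.parts.sort (· ≥ ·)).sum = N := by
    rw [← Multiset.sum_coe, Multiset.sort_eq, l.parts_sum]
  exact (card_cellsOfRowLens _).trans h

instance (l : N.Partition) : Nonempty (Tableau l) :=
  ⟨Fintype.equivFinOfCardEq (by rw [Fintype.card_coe, card_cells_diagram])⟩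

theorem rowLens_diagram (l : N.Partition) : (diagram l).rowLens = l.parts.sort (· ≥ ·) :=
  YoungDiagram.rowLens_ofRowLens_eq_self fun _ hx => l.parts_pos ((Multiset.mem_sort _).1 hx)

theorem diagram_injective : Function.Injective (diagram (N := N)) := by
  intro l m h
  have hsort : l.parts.sort (· ≥ ·) = m.parts.sort (· ≥ ·) := by
    rw [← rowLens_diagram, ← rowLens_diagram, h]
  apply Nat.Partition.ext
  rw [← Multiset.sort_eq l.parts (· ≥ ·), hsort, Multiset.sort_eq]

/-- The number of cells in the rows above row `i`: the partial sums of the row lengths, in terms of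
which the dominance order compares Young diagrams. -/
def cellsAbove (d : YoungDiagram) (i : ℕ) : ℕ := (d.cells.filter fun c => c.1 < i).card

theorem cellsAbove_succ (d : YoungDiagram) (i : ℕ) :
    cellsAbove d (i + 1) = cellsAbove d i + d.rowLen i := by
  rw [YoungDiagram.rowLen_eq_card, cellsAbove, cellsAbove, YoungDiagram.row,
    ← card_union_of_disjoint, ← filter_or]
  · simp only [Nat.lt_succ_iff_lt_or_eq]
  · exact disjoint_filter.2 fun _ _ hlt heq => hlt.ne heq

theorem eq_of_cellsAbove_eq {d e : YoungDiagram} (h : ∀ i, cellsAbove d i = cellsAbove e i) :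
    d = e := by
  have hrow (i : ℕ) : d.rowLen i = e.rowLen i := by
    have hd := cellsAbove_succ d i
    rw [h i, h (i + 1), cellsAbove_succ e i] at hd
    exact (Nat.add_left_cancel hd).symm
  ext ⟨i, j⟩
  rw [YoungDiagram.mem_cells, YoungDiagram.mem_cells, YoungDiagram.mem_iff_lt_rowLen,
    YoungDiagram.mem_iff_lt_rowLen, hrow]

theorem card_cells_above_col (d : YoungDiagram) (i j : ℕ) :
    (d.cells.filter fun c => c.1 < i ∧ c.2 = j).card = min i (d.colLen j) := by
  have hcells : (d.cells.filter fun c => c.1 < i ∧ c.2 = j) =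
      range (min i (d.colLen j)) ×ˢ {j} := by
    ext ⟨a, b⟩
    simp only [mem_filter, YoungDiagram.mem_cells, YoungDiagram.mem_iff_lt_colLen, mem_product,
      mem_range, lt_min_iff, mem_singleton]
    constructor
    · rintro ⟨h, h', rfl⟩
      exact ⟨⟨h', h⟩, rfl⟩
    · rintro ⟨⟨h, h'⟩, rfl⟩
      exact ⟨h', h, rfl⟩
  simp [hcells]

theorem cellsAbove_eq_sum_min (d : YoungDiagram) (i : ℕ) :
    cellsAbove d i = ∑ j ∈ d.cells.image Prod.snd, min i (d.colLen j) := by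
  rw [cellsAbove, card_eq_sum_card_fiberwise (f := Prod.snd) (t := d.cells.image Prod.snd)]
  · simp only [filter_filter, card_cells_above_col]
  · exact fun c hc => mem_coe.2 (mem_image_of_mem _ (mem_filter.1 hc).1)

end YoungDiagrams

section Tableaux

variable {N : ℕ} {l m : N.Partition}

theorem Tableau.cell_mem (t : Tableau l) (a : Fin N) : (t.row a, t.col a) ∈ diagram l :=
  (Equiv.symm t a).2

theorem Tableau.row_apply (t : Tableau l) (c : {c : ℕ × ℕ // c ∈ (diagram l).cells}) :
    t.row (Equiv.toFun t c) = c.1.1 :=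
  congrArg (fun x => x.1.1) (Equiv.symm_apply_apply t c)

theorem Tableau.col_apply (t : Tableau l) (c : {c : ℕ × ℕ // c ∈ (diagram l).cells}) :
    t.col (Equiv.toFun t c) = c.1.2 :=
  congrArg (fun x => x.1.2) (Equiv.symm_apply_apply t c)

theorem Tableau.ext_row_col (t : Tableau l) {a b : Fin N} (hr : t.row a = t.row b)
    (hc : t.col a = t.col b) : a = b :=
  (Equiv.symm t).injective (Subtype.ext (Prod.ext hr hc))

theorem Tableau.exists_smul_eq (s t : Tableau l) : ∃ g : Equiv.Perm (Fin N), g • s = t :=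
  ⟨(Equiv.symm s).trans t, Equiv.ext fun c => congrArg t.toFun (Equiv.symm_apply_apply s c)⟩

theorem Tableau.card_filter (t : Tableau l) (p : ℕ × ℕ → Prop) [DecidablePred p] :
    (univ.filter fun a => p (t.row a, t.col a)).card = ((diagram l).cells.filter p).card := by
  refine card_bij' (fun a _ => (t.row a, t.col a))
    (fun c hc => Equiv.toFun t ⟨c, (mem_filter.1 hc).1⟩) ?_ ?_ ?_ ?_
  · exact fun a ha => mem_filter.2 ⟨t.cell_mem a, (mem_filter.1 ha).2⟩
  · intro c hc
    refine mem_filter.2 ⟨mem_univ _, ?_⟩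
    rw [t.row_apply, t.col_apply]
    exact (mem_filter.1 hc).2
  · exact fun a _ => Equiv.apply_symm_apply t a
  · intro c hc
    rw [t.row_apply, t.col_apply]

theorem Tableau.card_col_eq (t : Tableau l) (j : ℕ) :
    (univ.filter fun a => t.col a = j).card = (diagram l).colLen j := by
  rw [YoungDiagram.colLen_eq_card]
  exact t.card_filter fun c => c.2 = j

theorem cellsAbove_eq_sum_card (s : Tableau m) (t : Tableau l) (i : ℕ) :
    cellsAbove (diagram m) i = ∑ j ∈ (diagram l).cells.image Prod.snd,
      (univ.filter fun a => s.row a < i ∧ t.col a = j).card := by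
  rw [cellsAbove, ← s.card_filter fun c => c.1 < i,
    card_eq_sum_card_fiberwise (f := t.col) (t := (diagram l).cells.image Prod.snd)]
  · simp only [filter_filter]
  · exact fun a _ => mem_coe.2 (mem_image_of_mem Prod.snd (t.cell_mem a))

/-- No two entries lie in the same row of `s` and in the same column of `t`: the combinatorial
condition for the column antisymmetrizer of `t` not to kill the tabloid of `s`. -/
def Separated (s : Tableau m) (t : Tableau l) : Prop :=
  ∀ a b, s.row a = s.row b → t.col a = t.col b → a = b

theorem Separated.card_le {s : Tableau m} {t : Tableau l} (h : Separated s t) (i j : ℕ) :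
    (univ.filter fun a => s.row a < i ∧ t.col a = j).card ≤ min i ((diagram l).colLen j) := by
  refine le_min ?_ ?_
  · refine (card_le_card_of_injOn (t := range i) s.row (fun a ha => ?_)
      fun a ha b hb hab => ?_).trans_eq (card_range i)
    · exact mem_coe.2 (mem_range.2 (mem_filter.1 ha).2.1)
    · exact h a b hab ((mem_filter.1 ha).2.2.trans (mem_filter.1 hb).2.2.symm)
  · rw [← t.card_col_eq]
    exact card_le_card (monotone_filter_right _ fun _ _ => And.right)

theorem Separated.cellsAbove_le {s : Tableau m} {t : Tableau l} (h : Separated s t) (i : ℕ) :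
    cellsAbove (diagram m) i ≤ cellsAbove (diagram l) i := by
  rw [cellsAbove_eq_sum_card s t, cellsAbove_eq_sum_min]
  exact sum_le_sum fun j _ => h.card_le i j

/-- For tableaux of the same shape the bounds `Separated.card_le` sum to an equality, so each of
them is one. -/
theorem Separated.card_eq {s t : Tableau l} (h : Separated s t) (i : ℕ) (a : Fin N) :
    (univ.filter fun b => s.row b < i ∧ t.col b = t.col a).card =
      min i ((diagram l).colLen (t.col a)) := by
  refine (sum_eq_sum_iff_of_le fun j _ => h.card_le i j).1 ?_ _
    (mem_image_of_mem Prod.snd (t.cell_mem a))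
  rw [← cellsAbove_eq_sum_card s t, cellsAbove_eq_sum_min]

theorem Separated.mem_diagram {s t : Tableau l} (h : Separated s t) (a : Fin N) :
    (s.row a, t.col a) ∈ diagram l := by
  have hlt : (univ.filter fun b => s.row b < s.row a ∧ t.col b = t.col a).card <
      (univ.filter fun b => s.row b < s.row a + 1 ∧ t.col b = t.col a).card :=
    card_lt_card <| (ssubset_iff_of_subset <| monotone_filter_right _ fun _ _ hb =>
      ⟨hb.1.trans (Nat.lt_succ_self _), hb.2⟩).2 ⟨a, by simp, by simp⟩
  rw [h.card_eq, h.card_eq] at hlt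
  rw [YoungDiagram.mem_iff_lt_colLen]
  omega

theorem Separated.exists_smul_tabloid_eq {s t : Tableau l} (h : Separated s t) :
    ∃ g ∈ t.columnStabilizer, g • t.tabloid = s.tabloid := by
  let f : Fin N → {c : ℕ × ℕ // c ∈ (diagram l).cells} := fun a => ⟨_, h.mem_diagram a⟩
  have hf : Function.Bijective f := by
    rw [Fintype.bijective_iff_injective_and_card]
    refine ⟨fun a b hab => ?_, by simp [card_cells_diagram]⟩
    exact h a b (congrArg (fun x => x.1.1) hab) (congrArg (fun x => x.1.2) hab)
  let e := Equiv.ofBijective f hf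
  let g : Equiv.Perm (Fin N) := (Equiv.symm t).trans e.symm
  have hg (k : Fin N) : f (g k) = Equiv.symm t k := e.apply_symm_apply _
  refine ⟨g, fun k => congrArg (fun x => x.1.2) (hg k),
    Tableau.tabloid_eq_iff.2 (funext fun k => ?_)⟩
  rw [Tableau.row_smul]
  exact congrArg (fun x => x.1.1) ((hg (g⁻¹ k)).symm.trans (congrArg f (g.apply_symm_apply k)))

end Tableaux

section Antisymmetrizers

variable {k V W : Type*} [CommRing k] [AddCommGroup V] [Module k V] [AddCommGroup W] [Module k W]
  {N : ℕ} {l : N.Partition}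

/-- The column antisymmetrizer `κ_t = ∑_{π ∈ C_t} sgn(π) π` of a tableau `t`, acting on an arbitrary
representation of the symmetric group. -/
noncomputable def Tableau.antisymmetrizer (t : Tableau l)
    (ρ : Representation k (Equiv.Perm (Fin N)) V) : V →ₗ[k] V :=
  ∑ g : Equiv.Perm (Fin N) with g ∈ t.columnStabilizer, Equiv.Perm.sign g • ρ g

variable {ρ : Representation k (Equiv.Perm (Fin N)) V}
  {σ : Representation k (Equiv.Perm (Fin N)) W}

theorem Tableau.antisymmetrizer_apply (t : Tableau l) (v : V) :
    t.antisymmetrizer ρ v =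
      ∑ g : Equiv.Perm (Fin N) with g ∈ t.columnStabilizer, Equiv.Perm.sign g • ρ g v := by
  simp [Tableau.antisymmetrizer]

theorem Tableau.antisymmetrizer_apply_apply (t : Tableau l) {h : Equiv.Perm (Fin N)}
    (hh : h ∈ t.columnStabilizer) (v : V) :
    t.antisymmetrizer ρ (ρ h v) = Equiv.Perm.sign h • t.antisymmetrizer ρ v := by
  rw [antisymmetrizer_apply, antisymmetrizer_apply, smul_sum]
  refine sum_equiv (Equiv.mulRight h) (fun g => ?_) fun g _ => ?_
  · simp only [mem_filter, mem_univ, true_and, Equiv.coe_mulRight]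
    exact (Subgroup.mul_mem_cancel_right _ hh).symm
  · rw [Equiv.coe_mulRight, Equiv.Perm.sign_mul, smul_smul, mul_comm (Equiv.Perm.sign g),
      ← mul_assoc, Int.units_mul_self, one_mul, map_mul, Module.End.mul_apply]

theorem Tableau.map_antisymmetrizer (t : Tableau l) (f : ρ.IntertwiningMap σ) (v : V) :
    f (t.antisymmetrizer ρ v) = t.antisymmetrizer σ (f v) := by
  simp only [antisymmetrizer_apply, Units.smul_def, map_sum, map_zsmul, f.isIntertwining]

theorem Tableau.coe_antisymmetrizer (t : Tableau l) (U : Subrepresentation ρ)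
    (u : U.toSubmodule) :
    (t.antisymmetrizer U.toRepresentation u : V) = t.antisymmetrizer ρ u := by
  simp only [antisymmetrizer_apply, Units.smul_def, Submodule.coe_sum, Submodule.coe_smul_of_tower]
  rfl

end Antisymmetrizers

section Polytabloids

variable {N : ℕ} {l m : N.Partition}

theorem permutationModule_single (g : Equiv.Perm (Fin N)) (x : Tabloid l) (c : ℂ) :
    permutationModule l g (.single x c) = .single (g • x) c :=
  Representation.ofMulAction_single ..

theorem span_single_tabloid :
    Submodule.span ℂ (Set.range fun s : Tableau l => MonoidAlgebra.single s.tabloid (1 : ℂ)) =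
      ⊤ := by
  refine eq_top_iff.2 fun u _ => ?_
  induction u using MonoidAlgebra.induction_linear with
  | zero => exact Submodule.zero_mem _
  | add x y hx hy => exact Submodule.add_mem _ (hx trivial) (hy trivial)
  | single x c =>
    obtain ⟨s, rfl⟩ : ∃ s : Tableau l, s.tabloid = x := Quotient.exists_rep x
    rw [← mul_one c, ← smul_eq_mul, ← MonoidAlgebra.smul_single]
    exact Submodule.smul_mem _ _ (Submodule.subset_span ⟨s, rfl⟩)

theorem Tableau.polytabloid_eq_sum (t : Tableau l) :
    t.polytabloid = ∑ g : Equiv.Perm (Fin N) with g ∈ t.columnStabilizer,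
      Equiv.Perm.sign g • MonoidAlgebra.single (g • t.tabloid) (1 : ℂ) := by
  simp [Tableau.polytabloid, smul_tabloid, Units.smul_def]

theorem Tableau.antisymmetrizer_single_tabloid (t : Tableau l) :
    t.antisymmetrizer (permutationModule l) (.single t.tabloid 1) = t.polytabloid := by
  simp only [antisymmetrizer_apply, polytabloid_eq_sum, permutationModule_single]

theorem Tableau.antisymmetrizer_polytabloid (t : Tableau l) :
    t.antisymmetrizer (permutationModule l) t.polytabloid =
      (univ.filter fun g => g ∈ t.columnStabilizer).card • t.polytabloid := by
  conv_lhs => rw [polytabloid_eq_sum, map_sum]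
  refine (sum_congr rfl fun g hg => ?_).trans (sum_const t.polytabloid)
  rw [Units.smul_def, map_zsmul, ← Units.smul_def, ← permutationModule_single,
    t.antisymmetrizer_apply_apply (mem_filter.1 hg).2, smul_smul, Int.units_mul_self, one_smul,
    antisymmetrizer_single_tabloid]

theorem Tableau.swap_mem_columnStabilizer {t : Tableau l} {a b : Fin N} (h : t.col a = t.col b) :
    Equiv.swap a b ∈ t.columnStabilizer := by
  intro k
  rw [Equiv.swap_apply_def]
  split_ifs with ha hb
  · rw [ha, h]
  · rw [hb, h]
  · rfl

theorem Tableau.swap_smul_tabloid {s : Tableau m} {a b : Fin N} (h : s.row a = s.row b) :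
    Equiv.swap a b • s.tabloid = s.tabloid := by
  rw [smul_tabloid, tabloid_eq_iff]
  funext k
  rw [row_smul, Equiv.swap_inv, Equiv.swap_apply_def]
  split_ifs with ha hb
  · rw [ha, h]
  · rw [hb, h]
  · rfl

theorem Tableau.antisymmetrizer_single_eq_zero {t : Tableau l} {s : Tableau m}
    (h : ¬ Separated s t) :
    t.antisymmetrizer (permutationModule m) (.single s.tabloid 1) = 0 := by
  simp only [Separated, not_forall] at h
  obtain ⟨a, b, hrow, hcol, hab⟩ := h
  have hneg := t.antisymmetrizer_apply_apply (ρ := permutationModule m)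
    (swap_mem_columnStabilizer hcol) (.single s.tabloid 1)
  rw [permutationModule_single, swap_smul_tabloid hrow, Equiv.Perm.sign_swap hab, Units.neg_smul,
    one_smul] at hneg
  have : IsAddTorsionFree ℂ[Tabloid m] := .of_isTorsionFree ℂ _
  exact self_eq_neg.1 hneg

theorem Tableau.antisymmetrizer_eq_zero {t : Tableau l} (h : ∀ s : Tableau m, ¬ Separated s t) :
    t.antisymmetrizer (permutationModule m) = 0 :=
  LinearMap.ext_on_range span_single_tabloid fun s => antisymmetrizer_single_eq_zero (h s)

theorem Tableau.antisymmetrizer_mem_span (t : Tableau l) (u : ℂ[Tabloid l]) :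
    t.antisymmetrizer (permutationModule l) u ∈ Submodule.span ℂ {t.polytabloid} := by
  suffices h : ⊤ ≤ (Submodule.span ℂ {t.polytabloid}).comap
      (t.antisymmetrizer (permutationModule l)) from h (Submodule.mem_top (x := u))
  rw [← span_single_tabloid, Submodule.span_le]
  rintro _ ⟨s, rfl⟩
  change t.antisymmetrizer (permutationModule l) (.single s.tabloid 1) ∈
    Submodule.span ℂ {t.polytabloid}
  by_cases h : Separated s t
  · obtain ⟨g, hg, hgt⟩ := h.exists_smul_tabloid_eq
    rw [← hgt, ← permutationModule_single, t.antisymmetrizer_apply_apply hg,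
      antisymmetrizer_single_tabloid]
    exact Submodule.smul_of_tower_mem _ _ (Submodule.mem_span_singleton_self _)
  · rw [antisymmetrizer_single_eq_zero h]
    exact Submodule.zero_mem _

theorem Tableau.coeff_antisymmetrizer (t : Tableau l) (u : ℂ[Tabloid l]) :
    (t.antisymmetrizer (permutationModule l) u).coeff t.tabloid =
      ∑ g : Equiv.Perm (Fin N) with g ∈ t.columnStabilizer,
        Equiv.Perm.sign g • u.coeff (g • t.tabloid) := by
  rw [antisymmetrizer_apply, MonoidAlgebra.coeff_sum, Finsupp.finsetSum_apply]
  refine sum_equiv (Equiv.inv _) (fun g => ?_) fun g _ => ?_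
  · simp
  · rw [Units.smul_def, MonoidAlgebra.coeff_smul, Finsupp.smul_apply, permutationModule,
      Representation.coeff_ofMulAction, Equiv.inv_apply, Equiv.Perm.sign_inv, Units.smul_def]

theorem Tableau.eq_one_of_smul_tabloid_eq {t : Tableau l} {g : Equiv.Perm (Fin N)}
    (hg : g ∈ t.columnStabilizer) (hgt : g • t.tabloid = t.tabloid) : g = 1 := by
  ext k : 1
  refine t.ext_row_col ?_ (hg k)
  have hrow := congrFun (tabloid_eq_iff.1 hgt) (g k)
  rw [row_smul, Equiv.Perm.inv_def, Equiv.symm_apply_apply] at hrow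
  exact hrow.symm

theorem Tableau.polytabloid_ne_zero (t : Tableau l) : t.polytabloid ≠ 0 := by
  intro h
  have hcoeff := t.coeff_antisymmetrizer (.single t.tabloid 1)
  rw [antisymmetrizer_single_tabloid, h, MonoidAlgebra.coeff_zero, Finsupp.zero_apply,
    sum_eq_single_of_mem 1 (mem_filter.2 ⟨mem_univ _, Subgroup.one_mem _⟩)] at hcoeff
  · simp at hcoeff
  · intro g hg hg1
    rw [MonoidAlgebra.coeff_single, Finsupp.single_eq_of_ne, smul_zero]
    exact fun hgt => hg1 (eq_one_of_smul_tabloid_eq (mem_filter.1 hg).2 hgt)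

end Polytabloids

section HermitianPairing

variable {X : Type*}

/-- The standard Hermitian form on `ℂ[X]`, as a linear functional of its second argument. -/
noncomputable def hermitianPairing (u : ℂ[X]) : ℂ[X] →ₗ[ℂ] ℂ :=
  Finsupp.linearCombination ℂ (fun x => (starRingEnd ℂ) (u.coeff x)) ∘ₗ
    (MonoidAlgebra.coeffLinearEquiv ℂ).toLinearMap

theorem hermitianPairing_single (u : ℂ[X]) (x : X) :
    hermitianPairing u (.single x 1) = (starRingEnd ℂ) (u.coeff x) := by
  simp [hermitianPairing]

theorem eq_zero_of_hermitianPairing_self {u : ℂ[X]} (h : hermitianPairing u u = 0) : u = 0 := by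
  have hsum : hermitianPairing u u =
      ((∑ x ∈ u.coeff.support, Complex.normSq (u.coeff x) : ℝ) : ℂ) := by
    simp [hermitianPairing, Finsupp.linearCombination_apply, Finsupp.sum, Complex.mul_conj]
  rw [hsum, Complex.ofReal_eq_zero,
    sum_eq_zero_iff_of_nonneg fun _ _ => Complex.normSq_nonneg _] at h
  apply MonoidAlgebra.coeff_injective
  ext x
  by_contra hx
  exact hx (Complex.normSq_eq_zero.1 (h x (Finsupp.mem_support_iff.2 hx)))

end HermitianPairing

section SpechtModules

variable {N : ℕ} {l m : N.Partition}

theorem hermitianPairing_polytabloid (t : Tableau l) (u : ℂ[Tabloid l]) :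
    hermitianPairing u t.polytabloid =
      (starRingEnd ℂ) ((t.antisymmetrizer (permutationModule l) u).coeff t.tabloid) := by
  simp only [t.coeff_antisymmetrizer, t.polytabloid_eq_sum, map_sum, Units.smul_def, map_zsmul,
    hermitianPairing_single]

theorem eq_zero_of_mem_spechtModule {u : ℂ[Tabloid l]} (hu : u ∈ (spechtModule l).toSubmodule)
    (h : ∀ t : Tableau l, t.antisymmetrizer (permutationModule l) u = 0) : u = 0 := by
  have hker : (spechtModule l).toSubmodule ≤ LinearMap.ker (hermitianPairing u) := by
    refine Submodule.span_le.2 ?_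
    rintro _ ⟨t, rfl⟩
    rw [SetLike.mem_coe, LinearMap.mem_ker, hermitianPairing_polytabloid, h,
      MonoidAlgebra.coeff_zero, Finsupp.zero_apply, map_zero]
  exact eq_zero_of_hermitianPairing_self (hker hu)

/-- The polytabloid of `t` as an element of the Specht module. -/
noncomputable def Tableau.spechtVector (t : Tableau l) : (spechtModule l).toSubmodule :=
  ⟨t.polytabloid, Submodule.subset_span ⟨t, rfl⟩⟩

theorem Tableau.spechtVector_ne_zero (t : Tableau l) : t.spechtVector ≠ 0 :=
  fun h => t.polytabloid_ne_zero (congrArg Subtype.val h)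

theorem specht_spechtVector (g : Equiv.Perm (Fin N)) (t : Tableau l) :
    specht l g t.spechtVector = (g • t).spechtVector :=
  Subtype.ext (permutationModule_polytabloid g t)

theorem span_spechtVector : Submodule.span ℂ (Set.range (Tableau.spechtVector (l := l))) = ⊤ := by
  apply Submodule.map_injective_of_injective (spechtModule l).toSubmodule.injective_subtype
  rw [Submodule.map_span, Submodule.map_top, Submodule.range_subtype, ← Set.range_comp]
  rfl

theorem Tableau.antisymmetrizer_specht_eq_zero_iff (t : Tableau l)
    (u : (spechtModule m).toSubmodule) :
    t.antisymmetrizer (specht m) u = 0 ↔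
      t.antisymmetrizer (permutationModule m) (u : ℂ[Tabloid m]) = 0 := by
  rw [← t.coe_antisymmetrizer (spechtModule m) u, Submodule.coe_eq_zero]
  rfl

theorem Tableau.antisymmetrizer_spechtVector (t : Tableau l) :
    t.antisymmetrizer (specht l) t.spechtVector =
      (univ.filter fun g => g ∈ t.columnStabilizer).card • t.spechtVector :=
  Subtype.ext ((t.coe_antisymmetrizer (spechtModule l) t.spechtVector).trans
    t.antisymmetrizer_polytabloid)

theorem Tableau.antisymmetrizer_specht_mem_span (t : Tableau l)
    (u : (spechtModule l).toSubmodule) :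
    t.antisymmetrizer (specht l) u ∈ Submodule.span ℂ {t.spechtVector} := by
  obtain ⟨c, hc⟩ := Submodule.mem_span_singleton.1 (t.antisymmetrizer_mem_span u)
  exact Submodule.mem_span_singleton.2
    ⟨c, Subtype.ext (hc.trans (t.coe_antisymmetrizer (spechtModule l) u).symm)⟩

theorem exists_antisymmetrizer_specht_ne_zero {u : (spechtModule l).toSubmodule} (hu : u ≠ 0) :
    ∃ t : Tableau l, t.antisymmetrizer (specht l) u ≠ 0 := by
  contrapose! hu
  exact Subtype.ext (eq_zero_of_mem_spechtModule u.2 fun t =>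
    (t.antisymmetrizer_specht_eq_zero_iff u).1 (hu t))

theorem eq_top_of_spechtVector_mem {U : Subrepresentation (specht l)} {t : Tableau l}
    (h : t.spechtVector ∈ U.toSubmodule) : U = ⊤ := by
  apply Subrepresentation.toSubmodule_injective
  change U.toSubmodule = ⊤
  rw [eq_top_iff, ← span_spechtVector, Submodule.span_le]
  rintro _ ⟨s, rfl⟩
  obtain ⟨g, rfl⟩ := t.exists_smul_eq s
  rw [← specht_spechtVector]
  exact U.apply_mem_toSubmodule g h

theorem eq_top_of_antisymmetrizer_ne_zero {U : Subrepresentation (specht l)}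
    {u : (spechtModule l).toSubmodule} (hu : u ∈ U.toSubmodule) {t : Tableau l}
    (ht : t.antisymmetrizer (specht l) u ≠ 0) : U = ⊤ := by
  obtain ⟨c, hc⟩ := Submodule.mem_span_singleton.1 (t.antisymmetrizer_specht_mem_span u)
  have hc0 : c ≠ 0 := fun h => ht (by rw [← hc, h, zero_smul])
  refine eq_top_of_spechtVector_mem (t := t) ((Submodule.smul_mem_iff _ hc0).1 ?_)
  rw [hc, ← t.coe_antisymmetrizer U ⟨u, hu⟩]
  exact Subtype.coe_prop _

theorem specht_isIrreducible (l : N.Partition) : (specht l).IsIrreducible where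
  exists_pair_ne := by
    obtain ⟨t⟩ : Nonempty (Tableau l) := inferInstance
    refine ⟨⊥, ⊤, fun h => t.spechtVector_ne_zero ((Submodule.mem_bot ℂ).1 ?_)⟩
    change t.spechtVector ∈ (⊥ : Subrepresentation (specht l)).toSubmodule
    rw [h]
    exact Submodule.mem_top
  eq_bot_or_eq_top U := by
    by_cases hU : ∃ u ∈ U.toSubmodule, u ≠ 0
    · obtain ⟨u, hu, hu0⟩ := hU
      obtain ⟨t, ht⟩ := exists_antisymmetrizer_specht_ne_zero hu0
      exact .inr (eq_top_of_antisymmetrizer_ne_zero hu ht)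
    · refine .inl (Subrepresentation.toSubmodule_injective ?_)
      push Not at hU
      exact (Submodule.eq_bot_iff _).2 hU

theorem exists_separated_of_intertwiningMap {f : (specht l).IntertwiningMap (specht m)}
    (hf : f ≠ 0) : ∃ (s : Tableau m) (t : Tableau l), Separated s t := by
  by_contra! hst
  refine hf (Representation.IntertwiningMap.toLinearMap_injective _ _
    (LinearMap.ext_on_range span_spechtVector fun t => ?_))
  have hcard : (univ.filter fun g => g ∈ t.columnStabilizer).card ≠ 0 :=
    card_ne_zero_of_mem (mem_filter.2 ⟨mem_univ _, t.columnStabilizer.one_mem⟩)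
  have hmap := t.map_antisymmetrizer f t.spechtVector
  rw [t.antisymmetrizer_spechtVector, map_nsmul, (t.antisymmetrizer_specht_eq_zero_iff _).2
    (by rw [Tableau.antisymmetrizer_eq_zero fun s => hst s t, LinearMap.zero_apply])] at hmap
  exact (smul_eq_zero_iff_right hcard).1 hmap

theorem cellsAbove_le_of_specht_equiv (e : (specht l).Equiv (specht m)) (i : ℕ) :
    cellsAbove (diagram m) i ≤ cellsAbove (diagram l) i := by
  obtain ⟨t⟩ : Nonempty (Tableau l) := inferInstance
  have he : e.toIntertwiningMap ≠ 0 := fun h => t.spechtVector_ne_zero <|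
    EquivLike.injective e <| (DFunLike.congr_fun h t.spechtVector).trans (map_zero e).symm
  obtain ⟨s, t, hst⟩ := exists_separated_of_intertwiningMap he
  exact hst.cellsAbove_le i

theorem eq_of_specht_equiv (e : (specht l).Equiv (specht m)) : l = m :=
  diagram_injective <| eq_of_cellsAbove_eq fun i =>
    le_antisymm (cellsAbove_le_of_specht_equiv e.symm i) (cellsAbove_le_of_specht_equiv e i)

end SpechtModules

section CoefficientSums

variable {k G X : Type*} [CommRing k] [Group G] [MulAction G X]

variable (k) in
/-- The linear functional on `k[X]` that adds up the coefficients at the elements of `S`. It is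
invariant under the stabilizer of `S`. -/
noncomputable def coeffSum (S : Set X) : k[X] →ₗ[k] k :=
  Finsupp.linearCombination k (S.indicator 1) ∘ₗ (MonoidAlgebra.coeffLinearEquiv k).toLinearMap

theorem coeffSum_single (S : Set X) (x : X) (c : k) :
    coeffSum k S (.single x c) = S.indicator (fun _ => c) x := by
  by_cases hx : x ∈ S <;> simp [coeffSum, hx]

theorem coeffSum_comp_ofMulAction {S : Set X} {g : G} (hS : ∀ x, g • x ∈ S ↔ x ∈ S) :
    coeffSum k S ∘ₗ Representation.ofMulAction k G X g = coeffSum k S := by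
  ext x
  by_cases hx : x ∈ S <;> simp [coeffSum_single, hS, hx]

end CoefficientSums

section AdaptedTableaux

variable {N : ℕ} {l : N.Partition}

theorem even_rowLen_diagram (hl : ∀ i ∈ l.parts, Even i) (i : ℕ) :
    Even ((diagram l).rowLen i) := by
  rcases Nat.eq_zero_or_pos ((diagram l).rowLen i) with h0 | hpos
  · rw [h0]
    exact Even.zero
  · have hi : i < (diagram l).rowLens.length := by
      rwa [YoungDiagram.length_rowLens, ← YoungDiagram.mem_iff_lt_colLen,
        YoungDiagram.mem_iff_lt_rowLen]
    have hmem := List.getElem_mem hi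
    rw [YoungDiagram.get_rowLens, rowLens_diagram, Multiset.mem_sort] at hmem
    exact hl _ hmem

theorem xor_one_lt {j r : ℕ} (hr : Even r) (h : j < r) : j ^^^ 1 < r := by
  rcases Nat.even_or_odd j with hj | hj
  · rw [Nat.xor_one_of_even hj]
    exact lt_of_le_of_ne h fun heq => Nat.even_add_one.1 (heq ▸ hr) hj
  · rw [Nat.xor_one_of_odd hj]
    exact (Nat.sub_le j 1).trans_lt h

theorem even_xor_one {j : ℕ} : Even (j ^^^ 1) ↔ ¬ Even j := by
  rw [Nat.even_xor, iff_false_right Nat.not_even_one]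

theorem exists_isMatching_cells (hl : ∀ i ∈ l.parts, Even i) :
    ∃ d : Equiv.Perm {c : ℕ × ℕ // c ∈ (diagram l).cells},
      IsMatching d ∧ ∀ c, (d c).1 = (c.1.1, c.1.2 ^^^ 1) := by
  have hmem (c : {c : ℕ × ℕ // c ∈ (diagram l).cells}) :
      (c.1.1, c.1.2 ^^^ 1) ∈ (diagram l).cells :=
    YoungDiagram.mem_iff_lt_rowLen.2 <| xor_one_lt (even_rowLen_diagram hl _) <|
      YoungDiagram.mem_iff_lt_rowLen.1 c.2
  have hinv : Function.Involutive fun c => (⟨_, hmem c⟩ : {c // c ∈ (diagram l).cells}) :=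
    fun c => Subtype.ext (Prod.ext rfl (Nat.xor_xor_cancel_right c.1.2 1))
  refine ⟨hinv.toPerm, ⟨Equiv.ext hinv, fun c h => ?_⟩, fun _ => rfl⟩
  have hcol : c.1.2 ^^^ 1 = c.1.2 := congrArg (fun c => c.1.2) h
  have hpar := even_xor_one (j := c.1.2)
  rw [hcol] at hpar
  exact iff_not_self hpar

/-- A tableau is adapted to a matching `x` of its entries if `x` exchanges the entries in the
columns `2k` and `2k + 1` of every row. -/
def Tableau.IsAdapted (t : Tableau l) (x : Equiv.Perm (Fin N)) : Prop :=
  ∀ a, t.row (x a) = t.row a ∧ t.col (x a) = t.col a ^^^ 1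

theorem IsMatching.exists_isAdapted {x : Equiv.Perm (Fin N)} (hx : IsMatching x)
    (hl : ∀ i ∈ l.parts, Even i) : ∃ t : Tableau l, t.IsAdapted x := by
  obtain ⟨d, hd, hd_eq⟩ := exists_isMatching_cells hl
  obtain ⟨t, rfl⟩ := hd.exists_permCongr_eq hx
    (by rw [Nat.card_eq_fintype_card, Fintype.card_coe, card_cells_diagram, Nat.card_fin])
  have hcell (a) : (t.symm (t.permCongr d a)).1 = ((t.symm a).1.1, (t.symm a).1.2 ^^^ 1) := by
    rw [Equiv.permCongr_apply, Equiv.symm_apply_apply, hd_eq]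
  exact ⟨t, fun a => Prod.ext_iff.1 (hcell a)⟩

/-- `g` is the product of its restriction to `S` and the conjugate of that restriction by `x`. -/
theorem sign_eq_one_of_commute {α : Type*} [Fintype α] [DecidableEq α] {g x : Equiv.Perm α}
    {S : Set α} (hgx : Commute g x) (hg : ∀ a, g a ∈ S ↔ a ∈ S) (hx : ∀ a, x a ∈ S ↔ a ∉ S) :
    Equiv.Perm.sign g = 1 := by
  classical
  let h : Equiv.Perm α := Equiv.Perm.ofSubtype (g.subtypePerm hg)
  have h_mem {a : α} (ha : a ∈ S) : h a = g a := Equiv.Perm.ofSubtype_apply_of_mem _ ha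
  have h_notMem {a : α} (ha : a ∉ S) : h a = a := Equiv.Perm.ofSubtype_apply_of_not_mem _ ha
  have hg_eq : g = h * (x * h * x⁻¹) := by
    ext a : 1
    obtain ⟨b, rfl⟩ := x.surjective a
    rw [Equiv.Perm.mul_apply, Equiv.Perm.mul_apply, Equiv.Perm.mul_apply, Equiv.Perm.inv_def,
      Equiv.symm_apply_apply]
    by_cases hb : b ∈ S
    · have hgb : x (g b) ∉ S := by rwa [hx, hg, not_not]
      rw [h_mem hb, h_notMem hgb]
      exact Equiv.congr_fun hgx b
    · rw [h_notMem hb, h_mem ((hx b).2 hb)]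
  rw [hg_eq, Equiv.Perm.sign_mul, Equiv.Perm.sign_mul, Equiv.Perm.sign_mul, Equiv.Perm.sign_inv,
    mul_right_comm (Equiv.Perm.sign x), Int.units_mul_self, one_mul, Int.units_mul_self]

theorem Tableau.IsAdapted.smul_tabloid_eq {t : Tableau l} {x : Equiv.Perm (Fin N)}
    (ht : t.IsAdapted x) : x • t.tabloid = t.tabloid :=
  smul_eq_iff_eq_inv_smul x |>.2 <| tabloid_eq_iff.2 <| funext fun a => by
    rw [row_smul, inv_inv, (ht a).1]

theorem Tableau.IsAdapted.commute {t : Tableau l} {x g : Equiv.Perm (Fin N)} (ht : t.IsAdapted x)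
    (hg : g ∈ t.columnStabilizer) (hgt : x • g • t.tabloid = g • t.tabloid) : Commute g x := by
  rw [← Commute.inv_left_iff]
  have hcol (a) : t.col (g⁻¹ a) = t.col a := inv_mem hg a
  have hrow (a) : t.row (g⁻¹ (x a)) = t.row (g⁻¹ a) := by
    have := congrFun (tabloid_eq_iff.1 hgt) (x a)
    rw [row_smul, row_smul, row_smul, Equiv.Perm.inv_def x, Equiv.symm_apply_apply] at this
    exact this.symm
  ext a : 1
  refine t.ext_row_col ?_ ?_
  · rw [Equiv.Perm.mul_apply, hrow, Equiv.Perm.mul_apply, (ht _).1]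
  · rw [Equiv.Perm.mul_apply, hcol, Equiv.Perm.mul_apply, (ht _).2, (ht _).2, hcol]

theorem Tableau.IsAdapted.sign_eq_one {t : Tableau l} {x g : Equiv.Perm (Fin N)}
    (ht : t.IsAdapted x) (hg : g ∈ t.columnStabilizer)
    (hgt : x • g • t.tabloid = g • t.tabloid) : Equiv.Perm.sign g = 1 := by
  refine sign_eq_one_of_commute (S := {a | Even (t.col a)}) (ht.commute hg hgt) ?_ ?_
  · intro a
    rw [Set.mem_ofPred_eq, hg a, Set.mem_ofPred_eq]
  · intro a
    rw [Set.mem_ofPred_eq, (ht a).2, even_xor_one, Set.mem_ofPred_eq]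

theorem Tableau.coeffSum_polytabloid (t : Tableau l) (S : Set (Tabloid l)) :
    coeffSum ℂ S t.polytabloid = ∑ g : Equiv.Perm (Fin N) with g ∈ t.columnStabilizer,
      Equiv.Perm.sign g • S.indicator 1 (g • t.tabloid) := by
  simp only [t.polytabloid_eq_sum, map_sum, Units.smul_def, map_zsmul, coeffSum_single]
  rfl

theorem Tableau.IsAdapted.coeffSum_polytabloid_ne_zero {t : Tableau l} {x : Equiv.Perm (Fin N)}
    (ht : t.IsAdapted x) :
    coeffSum ℂ (MulAction.fixedBy (Tabloid l) x) t.polytabloid ≠ 0 := by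
  classical
  have hcount : coeffSum ℂ (MulAction.fixedBy (Tabloid l) x) t.polytabloid =
      (univ.filter fun g => g ∈ t.columnStabilizer ∧ x • g • t.tabloid = g • t.tabloid).card := by
    rw [t.coeffSum_polytabloid, ← filter_filter, Finset.card_filter, Nat.cast_sum]
    refine sum_congr rfl fun g hg => ?_
    by_cases hgt : x • g • t.tabloid = g • t.tabloid
    · simp [hgt, ht.sign_eq_one (mem_filter.1 hg).2 hgt]
    · simp [hgt]
  rw [hcount, Nat.cast_ne_zero]
  refine card_ne_zero_of_mem (a := 1) (mem_filter.2 ⟨mem_univ _, one_mem _, ?_⟩)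
  rw [one_smul, ht.smul_tabloid_eq]

theorem exists_intertwiningMap_specht_ne_zero {n : ℕ} {l : (2 * n).Partition}
    (hl : ∀ i ∈ l.parts, Even i) : ∃ f : (inducedTrivial n).IntertwiningMap (specht l), f ≠ 0 := by
  obtain ⟨t, ht⟩ := (isMatching_matching n).exists_isAdapted hl
  let φ : (spechtModule l).toSubmodule →ₗ[ℂ] ℂ :=
    (coeffSum ℂ (MulAction.fixedBy (Tabloid l) (matching n))).domRestrict _
  have hφ (h) (hh : h ∈ hyperoctahedral n) : φ ∘ₗ specht l h = φ := by
    have hstable (T : Tabloid l) : h • T ∈ MulAction.fixedBy (Tabloid l) (matching n) ↔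
        T ∈ MulAction.fixedBy (Tabloid l) (matching n) := by
      rw [MulAction.mem_fixedBy, MulAction.mem_fixedBy, smul_smul,
        ← Subgroup.mem_centralizer_singleton_iff.1 hh, mul_smul, smul_left_cancel_iff]
    exact LinearMap.ext fun u => LinearMap.congr_fun (coeffSum_comp_ofMulAction hstable) u.1
  have hne : φ ≠ 0 := fun h =>
    ht.coeffSum_polytabloid_ne_zero (LinearMap.congr_fun h t.spechtVector)
  let _ : Fintype (hyperoctahedral n) := Fintype.ofFinite _
  let _ : Invertible (Fintype.card (hyperoctahedral n) : ℂ) :=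
    invertibleOfNonzero (Nat.cast_ne_zero.2 Fintype.card_ne_zero)
  exact exists_intertwiningMap_ne_zero hφ hne

end AdaptedTableaux

end SpechtMatching

theorem theorem1 (n : ℕ) :
    Nonempty ((SpechtMatching.inducedTrivial n).Equiv
      (Representation.directSum fun l : SpechtMatching.EvenPartition (2 * n) =>
        SpechtMatching.specht l.1)) ∧
    (∀ l : SpechtMatching.EvenPartition (2 * n), (SpechtMatching.specht l.1).IsIrreducible) ∧
    (∀ l m : SpechtMatching.EvenPartition (2 * n),
      Nonempty ((SpechtMatching.specht l.1).Equiv (SpechtMatching.specht m.1)) → l = m) := by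
  have hirr (l : SpechtMatching.EvenPartition (2 * n)) :
      (SpechtMatching.specht l.1).IsIrreducible :=
    SpechtMatching.specht_isIrreducible l.1
  have hdistinct (l m : SpechtMatching.EvenPartition (2 * n))
      (h : Nonempty ((SpechtMatching.specht l.1).Equiv (SpechtMatching.specht m.1))) : l = m :=
    h.elim fun e => Subtype.ext (SpechtMatching.eq_of_specht_equiv e)
  refine ⟨?_, hirr, hdistinct⟩
  choose f hf using fun l : SpechtMatching.EvenPartition (2 * n) =>
    SpechtMatching.exists_intertwiningMap_specht_ne_zero l.2
  exact SpechtMatching.nonempty_equiv_directSum hirr hdistinct f hf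
    (SpechtMatching.finrank_intertwiningMap_cosetRepresentation_le.trans
      (SpechtMatching.card_doubleCoset_hyperoctahedral_le n))
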